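/- Let $X$ be a finite-dimensional real vector space. A geometric graph $G=(V,E)$ in $X$ consists of a set $V\subseteq X$ of vertices and a set $E$ of edges, each edge $[v,w]$ joining two distinct members $v,w$ of $V$. A function $f\colon V\to X$ is a decomposing function for $G$ if $f(v)-f(w)$ is a scalar multiple of $v-w$ for every edge $[v,w]\in E$. The graph $G$ is indecomposable if every non-constant decomposing function for $G$ is the restriction to $V$ of a homothety $y\mapsto \alpha y+x$ with $\alpha\in\mathbb R\setminus\{0\}$, $x\in X$. The union of geometric graphs has as vertices and edges the unions of their vertex sets and of their edge sets. A polytope $P\subseteq X$ is the convex hull of a finite set of points; its dimension is that of its affine hull, and its skeleton is the geometric graph formed by its vertices and edges. $P$ is indecomposable if it is not the Minkowski sum $Q+R$ of two convex bodies $Q,R$ (nonempty compact convex sets), neither of them a single point, that are not similar, i.e. for which $Q$ is not of the form $cR+x$ with $c>0$ and $x\in X$. (i) Let $H=(V,E)$ be an indecomposable geometric graph in $X$ and, for each edge $e=[u,v]\in E$, let $G_e=(V_e,E_e)$ be an indecomposable geometric graph in $X$ with $u,v\in V_e$. Then the union $\bigcup_{e\in E}G_e$ is an indecomposable geometric graph.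 (ii) Let $n\ge 1$, let $G_1=(V_1,E_1),\dots,G_n=(V_n,E_n)$ be indecomposable geometric graphs in $X$ and let $v_1,\dots,v_n\in X$ be affinely independent. Set $G_0=G_n$ (so $V_0=V_n$) and suppose that $v_i\in V_i\cap V_{i-1}$ for each $i=1,\dots,n$. Then the union $G_1\cup G_2\cup\dots\cup G_n$ is indecomposable. (iii) Let $P\subseteq X$ be a polytope of dimension $d$, let $G_1=(V_1,E_1)$ and $G_2=(V_2,E_2)$ be two indecomposable subgraphs of the skeleton of $P$ with $V_1\cap V_2\neq\emptyset$, and suppose that $V_1\cup V_2$ contains all but at most $d-2$ vertices of $P$. Then $P$ is indecomposable. -/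

import Mathlib

open scoped Pointwise

/-- A geometric graph in `X`: a set of points of `X` together with a set of edges, each joining
two distinct members of that set (a subgraph of the complete graph on the points of `X`).
Unions of geometric graphs are the suprema `⊔`, `⨆` of subgraphs, "is a subgraph of" is `≤`. -/
abbrev GeometricGraph (X : Type*) := (⊤ : SimpleGraph X).Subgraph

namespace GeometricGraph

variable {X : Type*} [AddCommGroup X] [Module ℝ X]

/-- `f` is a decomposing function for `G`. Only the restriction of `f` to the vertex set matters
(both here and in `IsIndecomposable`); functions on the vertex set are written as functions
on `X` whose values elsewhere are irrelevant. -/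
def IsDecomposing (G : GeometricGraph X) (f : X → X) : Prop :=
  ∀ v w : X, G.Adj v w → ∃ c : ℝ, f v - f w = c • (v - w)

/-- `f` is constant on the vertices of `G`. -/
def IsConstantOnVerts (G : GeometricGraph X) (f : X → X) : Prop :=
  ∃ x : X, ∀ v ∈ G.verts, f v = x

/-- On the vertices of `G`, `f` is the restriction of a homothety of `X`
(with a positive or negative ratio). -/
def IsHomothetyOnVerts (G : GeometricGraph X) (f : X → X) : Prop :=
  ∃ a : ℝ, a ≠ 0 ∧ ∃ x : X, ∀ v ∈ G.verts, f v = a • v + x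

/-- The only non-constant decomposing functions of `G` are homotheties. -/
def IsIndecomposable (G : GeometricGraph X) : Prop :=
  ∀ f : X → X, G.IsDecomposing f → ¬ G.IsConstantOnVerts f → G.IsHomothetyOnVerts f

end GeometricGraph

namespace Polytope

variable {X : Type*} [NormedAddCommGroup X] [NormedSpace ℝ X]

/-- A polytope: the convex hull of a finite set of points. -/
def IsPolytope (P : Set X) : Prop :=
  ∃ s : Finset X, P = convexHull ℝ (s : Set X)

/-- The dimension of `P`, i.e. the dimension of its affine hull. -/
noncomputable def dim (P : Set X) : ℕ :=
  Module.finrank ℝ (vectorSpan ℝ P)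

/-- The skeleton of `P`: the geometric graph formed by the vertices (extreme points) of `P` and
its edges (the segments joining two vertices that are faces of `P`, i.e. that are cut out
of `P` by a supporting hyperplane, or are all of `P`). -/
def skeleton (P : Set X) : GeometricGraph X where
  verts := P.extremePoints ℝ
  Adj u v := u ∈ P.extremePoints ℝ ∧ v ∈ P.extremePoints ℝ ∧ u ≠ v ∧
    IsExposed ℝ P (segment ℝ u v)
  adj_sub h := h.2.2.1
  edge_vert h := h.1
  symm := ⟨fun u v h => ⟨h.2.1, h.1, h.2.2.1.symm, segment_symm ℝ u v ▸ h.2.2.2⟩⟩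

/-- Two sets are similar if one is obtained from the other by a dilation (of positive ratio)
followed by a translation. -/
def Similar (Q R : Set X) : Prop :=
  ∃ c : ℝ, 0 < c ∧ ∃ x : X, Q = (fun y => c • y + x) '' R

/-- `P` is decomposable if it is the Minkowski sum of two convex bodies that are not similar.
Single points are excluded as summands, since every `P` is trivially the sum of a point and
a translate of `P`. -/
def IsDecomposable (P : Set X) : Prop :=
  ∃ Q R : ConvexBody X, (Q : Set X).Nontrivial ∧ (R : Set X).Nontrivial ∧
    P = (Q : Set X) + (R : Set X) ∧ ¬ Similar (Q : Set X) (R : Set X)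

/-- `P` is indecomposable (with respect to Minkowski addition). -/
def IsIndecomposable (P : Set X) : Prop := ¬ IsDecomposable P

end Polytope

/-! On each indecomposable piece a decomposing function `f` of the union has the form `v ↦ a • v +
x`; the task is to make these local pairs `(a, x)` agree. In (i), two endpoints of an edge determine
the pair, and `H` ties the edges together. In (ii), summing the increments of `f` around the cycle
gives a linear relation among the `v i` whose coefficients sum to zero, so affine independence
equates consecutive ratios. For (iii), delete the missing vertices and one common vertex `v₀`. By
Balinski's theorem (`IsPolytope.iff_of_card_lt_dim`) the rest of the skeleton is connected, so some
edge crosses between the two graphs; with `v₀` it forms a nondegenerate triangle, forcing `a₁ = a₂`.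
Each missing vertex has two neighbours that are not missing, which determine `f` there. Finally, the
`Q`-parts of the vertices of `P = Q + R` form a decomposing function, so `Q` and `R` are both
homothetic to `P`. -/

namespace GeometricGraph

variable {X : Type*} [AddCommGroup X] [Module ℝ X]

/-! ### Unions of indecomposable graphs -/

/-- Allowing ratio `0` absorbs the constant functions, so no later argument needs to treat them
separately. -/
theorem IsIndecomposable.exists_smul_add {G : GeometricGraph X} (hG : G.IsIndecomposable)
    {f : X → X} (hf : G.IsDecomposing f) : ∃ (a : ℝ) (x : X), ∀ v ∈ G.verts, f v = a • v + x := by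
  by_cases hc : G.IsConstantOnVerts f
  · obtain ⟨x, hx⟩ := hc
    exact ⟨0, x, fun v hv => by simp [hx v hv]⟩
  · obtain ⟨a, -, x, hx⟩ := hG f hf hc
    exact ⟨a, x, hx⟩

theorem isIndecomposable_of_exists_smul_add {G : GeometricGraph X}
    (h : ∀ f, G.IsDecomposing f → ∃ (a : ℝ) (x : X), ∀ v ∈ G.verts, f v = a • v + x) :
    G.IsIndecomposable := by
  intro f hf hc
  obtain ⟨a, x, hx⟩ := h f hf
  refine ⟨a, ?_, x, hx⟩
  rintro rfl
  exact hc ⟨x, fun v hv => by simp [hx v hv]⟩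

theorem IsDecomposing.mono {G H : GeometricGraph X} (h : G ≤ H) {f : X → X}
    (hf : H.IsDecomposing f) : G.IsDecomposing f :=
  fun v w hvw => hf v w (h.2 hvw)

/-- Replacing each edge of an indecomposable graph by an indecomposable graph that contains its
endpoints yields an indecomposable graph. -/
theorem isIndecomposable_iSup_edgeSet (H : GeometricGraph X) (G : H.edgeSet → GeometricGraph X)
    (hH : H.IsIndecomposable) (hG : ∀ e, (G e).IsIndecomposable)
    (hmem : ∀ e : H.edgeSet, ∀ u ∈ (e : Sym2 X), u ∈ (G e).verts) :
    IsIndecomposable (⨆ e : H.edgeSet, G e) := by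
  apply isIndecomposable_of_exists_smul_add
  intro f hf
  choose a x hax using fun e => (hG e).exists_smul_add (hf.mono (le_iSup G e))
  have hfH : H.IsDecomposing f := by
    intro v w hvw
    let e : H.edgeSet := ⟨s(v, w), hvw⟩
    refine ⟨a e, ?_⟩
    rw [hax e v (hmem e v (Sym2.mem_mk_left v w)), hax e w (hmem e w (Sym2.mem_mk_right v w))]
    module
  obtain ⟨b, y, hby⟩ := hH.exists_smul_add hfH
  refine ⟨b, y, fun v hv => ?_⟩
  rw [SimpleGraph.Subgraph.verts_iSup, Set.mem_iUnion] at hv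
  obtain ⟨⟨e, he⟩, hv⟩ := hv
  induction e using Sym2.ind with
  | _ p q =>
    have hpq : H.Adj p q := he
    have hp := hax ⟨_, he⟩ p (hmem _ p (Sym2.mem_mk_left p q))
    have hq := hax ⟨_, he⟩ q (hmem _ q (Sym2.mem_mk_right p q))
    rw [hby p hpq.fst_mem] at hp
    rw [hby q hpq.snd_mem] at hq
    have hab : (b - a ⟨_, he⟩) • (p - q) = 0 := by
      linear_combination (norm := module) hp - hq
    have hb : b = a ⟨_, he⟩ := by
      rcases smul_eq_zero.1 hab with h | h
      · exact sub_eq_zero.1 h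
      · exact absurd (sub_eq_zero.1 h) hpq.ne
    rw [hax _ v hv, ← hb]
    rw [← hb] at hp
    rw [add_left_cancel hp]

/-- A cycle of indecomposable graphs in which consecutive graphs share vertices that are affinely
independent is indecomposable. -/
theorem isIndecomposable_iSup_cycle (n : ℕ) [NeZero n] (G : Fin n → GeometricGraph X)
    (v : Fin n → X) (hG : ∀ i, (G i).IsIndecomposable) (hv : AffineIndependent ℝ v)
    (hmem : ∀ i : Fin n, v i ∈ (G i).verts ∩ (G (i - 1)).verts) :
    IsIndecomposable (⨆ i : Fin n, G i) := by
  apply isIndecomposable_of_exists_smul_add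
  intro f hf
  choose a x hax using fun i => (hG i).exists_smul_add (hf.mono (le_iSup G i))
  have hmem' : ∀ i, v (i + 1) ∈ (G i).verts := fun i => by
    simpa using (hmem (i + 1)).2
  -- The increment of `f` from `v i` to `v (i + 1)` is computed inside `G i`; summed over the cycle
  -- the increments cancel, and reindexing collects the coefficients of each `v i`.
  have hsum : ∑ i, (a (i - 1) - a i) • v i = 0 := by
    have h1 : ∑ i, a (i - 1) • v i = ∑ i, a i • v (i + 1) := by
      rw [← Equiv.sum_comp (Equiv.addRight (1 : Fin n))]
      simp
    have h2 : ∑ i, f (v (i + 1)) = ∑ i, f (v i) :=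
      Equiv.sum_comp (Equiv.addRight (1 : Fin n)) (fun i => f (v i))
    have h3 : ∑ i, f (v (i + 1)) = ∑ i, a i • v (i + 1) + ∑ i, x i := by
      rw [← Finset.sum_add_distrib]
      exact Finset.sum_congr rfl fun i _ => hax i _ (hmem' i)
    have h4 : ∑ i, f (v i) = ∑ i, a i • v i + ∑ i, x i := by
      rw [← Finset.sum_add_distrib]
      exact Finset.sum_congr rfl fun i _ => hax i _ (hmem i).1
    rw [h3, h4] at h2
    simp only [sub_smul, Finset.sum_sub_distrib]
    rw [h1, add_right_cancel h2, sub_self]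
  have hzero : ∑ i, (a (i - 1) - a i) = 0 := by
    rw [Finset.sum_sub_distrib, sub_eq_zero]
    exact Equiv.sum_comp (Equiv.subRight (1 : Fin n)) a
  have ha : ∀ i, a (i + 1) = a i := fun i => by
    have := affineIndependent_iff.1 hv Finset.univ _ hzero hsum (i + 1) (Finset.mem_univ _)
    simp only [add_sub_cancel_right] at this
    linarith
  have hx : ∀ i, x (i + 1) = x i := fun i => by
    have h1 := hax i _ (hmem' i)
    rw [hax (i + 1) _ (hmem (i + 1)).1, ha] at h1
    exact add_left_cancel h1
  have hconst : ∀ i, a i = a 0 ∧ x i = x 0 := by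
    obtain _ | m := n
    · exact fun i => i.elim0
    · intro i
      induction i using Fin.induction with
      | zero => exact ⟨rfl, rfl⟩
      | succ i ih => rw [← Fin.coeSucc_eq_succ, ha, hx]; exact ih
  refine ⟨a 0, x 0, fun w hw => ?_⟩
  rw [SimpleGraph.Subgraph.verts_iSup, Set.mem_iUnion] at hw
  obtain ⟨i, hw⟩ := hw
  rw [hax i w hw, (hconst i).1, (hconst i).2]

end GeometricGraph

namespace Polytope

variable {X : Type*} [NormedAddCommGroup X] [NormedSpace ℝ X]

/-! ### Vertices, edges and linear functionals -/

theorem IsPolytope.convex {P : Set X} (hP : IsPolytope P) : Convex ℝ P := by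
  obtain ⟨s, rfl⟩ := hP
  exact convex_convexHull ℝ _

theorem IsPolytope.isCompact {P : Set X} (hP : IsPolytope P) : IsCompact P := by
  obtain ⟨s, rfl⟩ := hP
  exact s.finite_toSet.isCompact_convexHull ℝ

theorem IsPolytope.finite_extremePoints {P : Set X} (hP : IsPolytope P) :
    (P.extremePoints ℝ).Finite := by
  obtain ⟨s, rfl⟩ := hP
  exact s.finite_toSet.subset extremePoints_convexHull_subset

/-- A compact convex set with finitely many extreme points is their convex hull. -/
theorem convexHull_extremePoints_eq {P : Set X} (hc : IsCompact P) (hconv : Convex ℝ P)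
    (hfin : (P.extremePoints ℝ).Finite) : convexHull ℝ (P.extremePoints ℝ) = P := by
  rw [← (hfin.isCompact_convexHull ℝ).isClosed.closure_eq]
  exact closure_convexHull_extremePoints hc hconv

/-- A continuous functional on a nonempty polytope is maximised at a vertex. -/
theorem IsPolytope.exists_extremePoint_forall_le {P : Set X} (hP : IsPolytope P)
    (hne : P.Nonempty) (l : StrongDual ℝ X) : ∃ v ∈ P.extremePoints ℝ, ∀ y ∈ P, l y ≤ l v := by
  have hexp : IsExposed ℝ P (l.toExposed P) := ContinuousLinearMap.toExposed.isExposed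
  obtain ⟨m, hm, hmax⟩ := hP.isCompact.exists_isMaxOn hne l.continuous.continuousOn
  obtain ⟨v, hv⟩ := (hexp.isCompact hP.isCompact).extremePoints_nonempty ⟨m, hm, fun y hy => hmax hy⟩
  exact ⟨v, hexp.isExtreme.extremePoints_subset_extremePoints hv, (extremePoints_subset hv).2⟩

/-- Three distinct extreme points are not collinear. -/
theorem smul_sub_eq_smul_sub_of_extremePoints {P : Set X} {p q r : X}
    (hp : p ∈ P.extremePoints ℝ) (hq : q ∈ P.extremePoints ℝ) (hr : r ∈ P.extremePoints ℝ)
    (hpq : p ≠ q) (hpr : p ≠ r) (hqr : q ≠ r) {α β : ℝ}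
    (h : α • (q - p) = β • (r - p)) : α = 0 ∧ β = 0 := by
  by_cases hα : α = 0
  · subst hα
    rw [zero_smul, eq_comm, smul_eq_zero, sub_eq_zero] at h
    exact ⟨rfl, h.resolve_right hpr.symm⟩
  exfalso
  obtain ⟨t, ht⟩ : ∃ t : ℝ, q - p = t • (r - p) := ⟨α⁻¹ * β, by
    rw [mul_smul, ← h, inv_smul_smul₀ hα]⟩
  have hq' : q = p + t • (r - p) := by rw [← ht]; abel
  have ht0 : t ≠ 0 := by
    rintro rfl
    exact hpq (by simpa using hq'.symm)
  have ht1 : t ≠ 1 := by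
    rintro rfl
    exact hqr (by simpa using hq')
  -- The cases `t < 0`, `0 < t < 1`, `1 < t` put `p`, `q`, `r` respectively strictly between the
  -- other two, contradicting extremality.
  rcases lt_or_gt_of_ne ht0 with h0 | h0
  · refine hpq (hp.2 hq.1 hr.1 ⟨1 / (1 - t), -t / (1 - t), ?_, ?_, ?_, ?_⟩).symm
    · exact div_pos one_pos (by linarith)
    · exact div_pos (by linarith) (by linarith)
    · have : 1 - t ≠ 0 := by linarith
      field_simp
      ring
    · have : 1 - t ≠ 0 := by linarith
      rw [hq']
      match_scalars <;> field_simp <;> ring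
  rcases lt_or_gt_of_ne ht1 with h1 | h1
  · refine hpq (hq.2 hp.1 hr.1 ⟨1 - t, t, by linarith, h0, by ring, ?_⟩)
    rw [hq']
    module
  · refine hpr (hr.2 hp.1 hq.1 ⟨1 - 1 / t, 1 / t, ?_, by positivity, by ring, ?_⟩)
    · rw [sub_pos, div_lt_one h0]
      exact h1
    · rw [hq']
      match_scalars <;> field_simp <;> ring

/-- A functional can be perturbed so that it vanishes at none of finitely many nonzero vectors,
and stays positive where it was positive. -/
theorem exists_perturbation [FiniteDimensional ℝ X] {Z : Set X} (hZ : Z.Finite)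
    (h0 : ∀ z ∈ Z, z ≠ 0) (l : StrongDual ℝ X) :
    ∃ m : StrongDual ℝ X, (∀ z ∈ Z, m z ≠ 0) ∧ ∀ z ∈ Z, 0 < l z → 0 < m z := by
  have := hZ.to_subtype
  obtain ⟨n', hn'⟩ := Module.exists_dual_forall_apply_ne_zero (K := ℝ) (fun z : Z => (z : X))
    (fun z => h0 z z.2)
  let n : StrongDual ℝ X := LinearMap.toContinuousLinearMap n'
  have hn : ∀ z ∈ Z, n z ≠ 0 := fun z hz => hn' ⟨z, hz⟩
  -- The perturbation is `l + ε • n` with small `ε > 0`: nonzero and positive values of `l` survive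
  -- by continuity, and where `l` vanishes `ε • n` does not.
  have hlim : ∀ z, Filter.Tendsto (fun ε : ℝ => (l + ε • n) z) (nhdsWithin 0 (Set.Ioi 0))
      (nhds (l z)) := by
    intro z
    have : Continuous fun ε : ℝ => (l + ε • n) z := by
      simp only [add_apply, smul_apply]
      fun_prop
    simpa using (this.tendsto 0).mono_left nhdsWithin_le_nhds
  have hev : ∀ᶠ ε : ℝ in nhdsWithin 0 (Set.Ioi 0), ∀ z ∈ Z,
      (l + ε • n) z ≠ 0 ∧ (0 < l z → 0 < (l + ε • n) z) := by
    rw [Filter.eventually_all_finite hZ]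
    intro z hz
    have h1 : ∀ᶠ ε : ℝ in nhdsWithin 0 (Set.Ioi 0), (l + ε • n) z ≠ 0 := by
      by_cases hlz : l z = 0
      · filter_upwards [self_mem_nhdsWithin] with ε hε
        have : ε ≠ 0 := ne_of_gt hε
        simp [hlz, this, hn z hz]
      · exact (hlim z).eventually_ne hlz
    have h2 : ∀ᶠ ε : ℝ in nhdsWithin 0 (Set.Ioi 0), 0 < l z → 0 < (l + ε • n) z := by
      by_cases hlz : 0 < l z
      · filter_upwards [(hlim z).eventually_const_lt hlz] with ε hε _ using hε
      · exact Filter.Eventually.of_forall fun ε h => absurd h hlz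
    exact h1.and h2
  obtain ⟨ε, hε⟩ := hev.exists
  exact ⟨l + ε • n, fun z hz => (hε z hz).1, fun z hz => (hε z hz).2⟩

/-- A functional whose maximum over the vertices is attained at exactly two vertices exposes the
edge joining them. -/
theorem IsPolytope.skeleton_adj_of_forall_lt {P : Set X} (hP : IsPolytope P) {u v : X}
    (hu : u ∈ P.extremePoints ℝ) (hv : v ∈ P.extremePoints ℝ) (huv : u ≠ v)
    (l : StrongDual ℝ X) (heq : l u = l v)
    (hlt : ∀ w ∈ P.extremePoints ℝ, w ≠ u → w ≠ v → l w < l u) : (skeleton P).Adj u v := by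
  refine ⟨hu, hv, huv, fun _ => ⟨l, ?_⟩⟩
  have hmax : ∀ y ∈ P, l y ≤ l u := by
    obtain ⟨w, hw, hwmax⟩ := hP.exists_extremePoint_forall_le ⟨u, hu.1⟩ l
    intro y hy
    refine (hwmax y hy).trans ?_
    by_cases h1 : w = u
    · rw [h1]
    by_cases h2 : w = v
    · rw [h2, heq]
    exact (hlt w hw h1 h2).le
  apply Set.Subset.antisymm
  · intro x hx
    have hxu : l x = l u := by
      obtain ⟨a, b, -, -, hab, rfl⟩ := hx
      simp only [map_add, map_smul, smul_eq_mul, ← heq]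
      rw [← add_mul, hab, one_mul]
    exact ⟨hP.convex.segment_subset hu.1 hv.1 hx, fun y hy => hxu ▸ hmax y hy⟩
  · have hexp : IsExposed ℝ P (l.toExposed P) := ContinuousLinearMap.toExposed.isExposed
    have hsub : (l.toExposed P).extremePoints ℝ ⊆ {u, v} := by
      intro w hw
      by_contra hne
      simp only [Set.mem_insert_iff, Set.mem_singleton_iff, not_or] at hne
      have h1 := hlt w (hexp.isExtreme.extremePoints_subset_extremePoints hw) hne.1 hne.2
      have h2 := (extremePoints_subset hw).2 u hu.1
      linarith
    change l.toExposed P ⊆ _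
    rw [← convexHull_extremePoints_eq (hexp.isCompact hP.isCompact) (hexp.convex hP.convex)
      ((Set.toFinite {u, v}).subset hsub), ← convexHull_pair]
    exact convexHull_mono hsub

/-- Every vertex is the unique vertex at which some functional is maximal. -/
theorem IsPolytope.exists_forall_extremePoints_lt {P : Set X} (hP : IsPolytope P) {v : X}
    (hv : v ∈ P.extremePoints ℝ) :
    ∃ m : StrongDual ℝ X, ∀ u ∈ P.extremePoints ℝ, u ≠ v → m u < m v := by
  have hnot : v ∉ convexHull ℝ (P.extremePoints ℝ \ {v}) := fun h =>
    (hP.convex.mem_extremePoints_iff_mem_sdiff_convexHull_sdiff.1 hv).2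
      (convexHull_mono (Set.sdiff_subset_sdiff_left extremePoints_subset) h)
  obtain ⟨m, c, h1, h2⟩ := geometric_hahn_banach_closed_point (convex_convexHull ℝ _)
    ((hP.finite_extremePoints.subset Set.sdiff_subset).isCompact_convexHull ℝ).isClosed hnot
  exact ⟨m, fun u hu huv => (h1 u (subset_convexHull ℝ _ ⟨hu, huv⟩)).trans h2⟩

/-! ### Simplex pivoting and Balinski's theorem -/

/-- The pivoting step of the simplex method: a vertex at which a functional is not maximal has a
neighbour at which the functional is larger. -/
theorem IsPolytope.exists_adj_lt [FiniteDimensional ℝ X] {P : Set X} (hP : IsPolytope P) {v p : X}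
    (hv : v ∈ P.extremePoints ℝ) (l : StrongDual ℝ X) (hp : p ∈ P) (hvp : l v < l p) :
    ∃ u, (skeleton P).Adj v u ∧ l v < l u := by
  have hfin := hP.finite_extremePoints
  obtain ⟨m₀, hm₀⟩ := hP.exists_forall_extremePoints_lt hv
  set E := P.extremePoints ℝ with hE
  let U : Set X := {u ∈ E | l v < l u}
  have hU : U.Finite := hfin.subset (Set.sep_subset _ _)
  have hUne : U.Nonempty := by
    obtain ⟨w, hw, hwmax⟩ := hP.exists_extremePoint_forall_le ⟨p, hp⟩ l
    exact ⟨w, hw, hvp.trans_le (hwmax p hp)⟩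
  -- `m (d (q, r)) = 0` says exactly that `q` and `r` tie in the ratio `(m v - m u) / (l u - l v)`
  -- minimised below.
  let d : X × X → X := fun q => (l q.2 - l v) • (v - q.1) - (l q.1 - l v) • (v - q.2)
  let Z : Set X := (fun u => v - u) '' (E \ {v}) ∪ d '' ((U ×ˢ U) \ {q | q.1 = q.2})
  have hZ : Z.Finite :=
    ((hfin.subset Set.sdiff_subset).image _).union (((hU.prod hU).subset Set.sdiff_subset).image _)
  have hZ0 : ∀ z ∈ Z, z ≠ 0 := by
    rintro z (⟨u, hu, rfl⟩ | ⟨⟨q, r⟩, ⟨⟨hq, hr⟩, hqr⟩, rfl⟩)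
    · exact sub_ne_zero.2 (Ne.symm hu.2)
    · intro h
      have hvq : v ≠ q := fun h => lt_irrefl _ (h ▸ hq.2)
      have hvr : v ≠ r := fun h => lt_irrefl _ (h ▸ hr.2)
      have h' : (l r - l v) • (q - v) = (l q - l v) • (r - v) := by
        have h : (l r - l v) • (v - q) - (l q - l v) • (v - r) = 0 := h
        linear_combination (norm := module) -h
      have h3 := (smul_sub_eq_smul_sub_of_extremePoints hv hq.1 hr.1 hvq hvr hqr h').1
      have h4 : l v < l r := hr.2
      linarith
  obtain ⟨m, hm0, hmpos⟩ := exists_perturbation hZ hZ0 m₀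
  have hm : ∀ u ∈ E, u ≠ v → m u < m v := by
    intro u hu huv
    have := hmpos (v - u) (Or.inl ⟨u, ⟨hu, huv⟩, rfl⟩) (by
      rw [map_sub, sub_pos]; exact hm₀ u hu huv)
    rwa [map_sub, sub_pos] at this
  -- As `m` is tilted to `m + t • l` with growing `t`, the first vertex to catch up with `v` is the
  -- minimiser of this ratio; genericity makes it unique, so `v` and `u` span an edge.
  obtain ⟨u, hu, hmin⟩ := hU.exists_minimalFor (fun u => (m v - m u) / (l u - l v)) U hUne
  have hmin' : ∀ w ∈ U, (m v - m u) / (l u - l v) ≤ (m v - m w) / (l w - l v) := fun w hw =>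
    (le_total _ _).elim id fun h => hmin hw h
  have hlu : 0 < l u - l v := sub_pos.2 hu.2
  have huv : u ≠ v := fun h => lt_irrefl _ (h ▸ hu.2)
  set t := (m v - m u) / (l u - l v) with ht
  have ht0 : 0 < t := div_pos (sub_pos.2 (hm u hu.1 huv)) hlu
  have htu : t * (l u - l v) = m v - m u := div_mul_cancel₀ _ hlu.ne'
  refine ⟨u, hP.skeleton_adj_of_forall_lt hv hu.1 huv.symm (m + t • l) ?_ ?_, hu.2⟩
  · simp only [add_apply, smul_apply, smul_eq_mul]
    linarith
  · intro w hw hwv hwu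
    simp only [add_apply, smul_apply, smul_eq_mul]
    have hmw := hm w hw hwv
    by_cases hlw : l v < l w
    · have hlw' : 0 < l w - l v := sub_pos.2 hlw
      have hle : t * (l w - l v) ≤ m v - m w := (le_div_iff₀ hlw').1 (hmin' w ⟨hw, hlw⟩)
      have hne : t * (l w - l v) ≠ m v - m w := by
        intro heq
        refine hm0 (d (u, w)) (Or.inr ⟨(u, w), ⟨⟨hu, hw, hlw⟩, Ne.symm hwu⟩, rfl⟩) ?_
        simp only [d, map_sub, map_smul, smul_eq_mul, ← heq, ← htu]
        ring
      have := lt_of_le_of_ne hle hne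
      linarith
    · have : t * l w ≤ t * l v := mul_le_mul_of_nonneg_left (not_lt.1 hlw) ht0.le
      linarith

/-- The vertices on or above a hyperplane that contains all of `S`, and that are not in `S`, lie
in one component of the skeleton with `S` removed. -/
theorem IsPolytope.exists_iff_of_le [FiniteDimensional ℝ X] {P : Set X} (hP : IsPolytope P)
    {S : Set X} {φ : X → Prop}
    (hφ : ∀ u w, (skeleton P).Adj u w → u ∉ S → w ∉ S → (φ u ↔ φ w))
    (l : StrongDual ℝ X) {c : ℝ} (hS : ∀ s ∈ S, l s = c) (hc : ∃ p ∈ P, c < l p) :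
    ∃ τ : Prop, ∀ x ∈ P.extremePoints ℝ, x ∉ S → c ≤ l x → (φ x ↔ τ) := by
  obtain ⟨p, hp, hcp⟩ := hc
  have hfin := hP.finite_extremePoints
  let E := P.extremePoints ℝ
  let Z : Set X := (fun q : X × X => q.1 - q.2) '' ((E ×ˢ E) \ {q | q.1 = q.2})
  obtain ⟨m, hm0, hmpos⟩ := exists_perturbation (Z := Z)
    (((hfin.prod hfin).subset Set.sdiff_subset).image _)
    (by rintro z ⟨q, hq, rfl⟩; exact sub_ne_zero.2 hq.2) l
  have hinj : ∀ x ∈ E, ∀ y ∈ E, m x = m y → x = y := by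
    intro x hx y hy hxy
    by_contra hne
    exact hm0 (x - y) ⟨(x, y), ⟨⟨hx, hy⟩, hne⟩, rfl⟩ (by rw [map_sub, hxy, sub_self])
  have hmono : ∀ x ∈ E, ∀ y ∈ E, m x < m y → l x ≤ l y := by
    intro x hx y hy hxy
    by_contra! hlt
    have hne : x ≠ y := fun h => lt_irrefl _ (h ▸ hxy)
    have := hmpos (x - y) ⟨(x, y), ⟨⟨hx, hy⟩, hne⟩, rfl⟩ (by rwa [map_sub, sub_pos])
    rw [map_sub, sub_pos] at this
    exact lt_asymm this hxy
  obtain ⟨M, hM, hMmax⟩ := hP.exists_extremePoint_forall_le ⟨p, hp⟩ m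
  have hnotin : ∀ x, c < l x → x ∉ S := fun x hx hxS => hx.ne' (hS x hxS)
  have habove : ∀ x ∈ E, c < l x → (φ x ↔ φ M) := by
    by_contra! hcon
    let B : Set X := {x ∈ E | c < l x ∧ ¬ (φ x ↔ φ M)}
    have hBne : B.Nonempty := by
      obtain ⟨x, hx, hcx, h⟩ := hcon
      exact ⟨x, hx, hcx, by tauto⟩
    have hBfin : B.Finite := hfin.subset (Set.sep_subset _ _)
    -- Pivoting from the `m`-highest exception leads to a vertex still above `c`, hence outside `S`,
    -- with the same colour: a higher exception.
    obtain ⟨x, ⟨hx, hcx, hxM⟩, hmax⟩ := hBfin.exists_maximalFor m B hBne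
    have hne : x ≠ M := by
      rintro rfl
      exact hxM Iff.rfl
    have hlt : m x < m M := lt_of_le_of_ne (hMmax x hx.1) fun h => hne (hinj x hx M hM h)
    obtain ⟨y, hxy, hmy⟩ := hP.exists_adj_lt hx m hM.1 hlt
    have hy : y ∈ E := hxy.2.1
    have hcy : c < l y := hcx.trans_le (hmono x hx y hy hmy)
    have hiff := hφ x y hxy (hnotin x hcx) (hnotin y hcy)
    exact absurd (hmax ⟨hy, hcy, by rwa [← hiff]⟩ hmy.le) (not_le.2 hmy)
  refine ⟨φ M, fun x hx hxS hcx => ?_⟩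
  rcases hcx.lt_or_eq with h | h
  · exact habove x hx h
  -- One pivot with `l` itself leaves the hyperplane.
  · obtain ⟨y, hxy, hly⟩ := hP.exists_adj_lt hx l hp (h ▸ hcp)
    have hcy : c < l y := h ▸ hly
    rw [hφ x y hxy hxS (hnotin y hcy)]
    exact habove y hxy.2.1 hcy

/-- A set with at most `dim P` points lies in a hyperplane that does not contain `P`. -/
theorem exists_dual_eq_const [FiniteDimensional ℝ X] {P : Set X} {T : Finset X} {u : X}
    (hu : u ∈ T) (hT : T.card ≤ dim P) :
    ∃ l : StrongDual ℝ X, (∀ s ∈ T, l s = l u) ∧ ∃ p ∈ P, ∃ q ∈ P, l p ≠ l q := by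
  have : Nonempty T := ⟨⟨u, hu⟩⟩
  have hlt : Module.finrank ℝ (vectorSpan ℝ (T : Set X)) + 1 ≤ T.card := by
    have h := finrank_vectorSpan_range_add_one_le ℝ (fun x : T => (x : X))
    rwa [Fintype.card_coe, show Set.range (fun x : T => (x : X)) = T from Subtype.range_coe] at h
  have hnle : ¬ vectorSpan ℝ P ≤ vectorSpan ℝ (T : Set X) := fun h => by
    have := Submodule.finrank_mono h
    unfold dim at hT
    omega
  obtain ⟨x, hxP, hxT⟩ := SetLike.not_le_iff_exists.1 hnle
  obtain ⟨l, hlx, hl⟩ := Submodule.exists_le_ker_of_notMem hxT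
  refine ⟨LinearMap.toContinuousLinearMap l, fun s hs => ?_, ?_⟩
  · have := hl (vsub_mem_vectorSpan ℝ (Finset.mem_coe.2 hs) (Finset.mem_coe.2 hu))
    rw [LinearMap.mem_ker, vsub_eq_sub, map_sub, sub_eq_zero] at this
    exact this
  · by_contra! hcon
    have hle : vectorSpan ℝ P ≤ LinearMap.ker l := by
      rw [vectorSpan_def, Submodule.span_le]
      rintro _ ⟨p, hp, q, hq, rfl⟩
      simpa [sub_eq_zero] using hcon p hp q hq
    exact hlx (hle hxP)

/-- **Balinski's theorem**, in terms of two-colourings: the skeleton of a `d`-dimensional polytope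
remains connected when fewer than `d` vertices are removed. -/
theorem IsPolytope.iff_of_card_lt_dim [FiniteDimensional ℝ X] {P : Set X} (hP : IsPolytope P)
    {S : Finset X} (hS : S.card < dim P) {φ : X → Prop}
    (hφ : ∀ u w, (skeleton P).Adj u w → u ∉ S → w ∉ S → (φ u ↔ φ w)) {u w : X}
    (hu : u ∈ P.extremePoints ℝ) (huS : u ∉ S) (hw : w ∈ P.extremePoints ℝ) (hwS : w ∉ S) :
    φ u ↔ φ w := by
  classical
  -- Putting `u` on the hyperplane along with `S` places it on both closed sides, so it shares one
  -- with `w`. If `w` is on the hyperplane too, `p` and `q` ensure that `P` extends strictly to some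
  -- side.
  obtain ⟨l, hl, p, hp, q, hq, hpq⟩ := exists_dual_eq_const (P := P) (Finset.mem_insert_self u S)
    ((Finset.card_insert_le u S).trans hS)
  have key : ∀ l : StrongDual ℝ X, (∀ s ∈ insert u S, l s = l u) → (∃ p ∈ P, l u < l p) →
      l u ≤ l w → (φ u ↔ φ w) := by
    intro l hl hp hle
    obtain ⟨τ, hτ⟩ := hP.exists_iff_of_le (S := S) hφ l
      (fun s hs => hl s (Finset.mem_insert_of_mem hs)) hp
    rw [hτ u hu huS le_rfl, hτ w hw hwS hle]
  have hl' : ∀ s ∈ insert u S, (-l) s = (-l) u := fun s hs => by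
    simpa using hl s hs
  rcases lt_trichotomy (l w) (l u) with h | h | h
  · exact key (-l) hl' ⟨w, hw.1, by simpa using h⟩ (by simpa using h.le)
  · by_cases h' : ∃ p ∈ P, l u < l p
    · exact key l hl h' h.ge
    · push Not at h'
      refine key (-l) hl' ?_ (by simpa using h.le)
      rcases (h' p hp).lt_or_eq with h1 | h1
      · exact ⟨p, hp, by simpa using h1⟩
      · exact ⟨q, hq, by simpa using lt_of_le_of_ne (h' q hq) (h1 ▸ hpq.symm)⟩
  · exact key l hl ⟨w, hw.1, h⟩ h.le

/-- A nonempty polytope has more vertices than its dimension. -/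
theorem IsPolytope.dim_lt_ncard [FiniteDimensional ℝ X] {P : Set X} (hP : IsPolytope P)
    (hne : P.Nonempty) : dim P < (P.extremePoints ℝ).ncard := by
  have hfin := hP.finite_extremePoints
  have h1 : dim P = Module.finrank ℝ (vectorSpan ℝ (P.extremePoints ℝ)) := by
    rw [dim, ← direction_affineSpan, ← direction_affineSpan]
    conv_lhs => rw [← convexHull_extremePoints_eq hP.isCompact hP.convex hfin]
    rw [affineSpan_convexHull]
  have := hfin.fintype
  have : Nonempty (P.extremePoints ℝ) := (hP.isCompact.extremePoints_nonempty hne).to_subtype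
  have h2 := finrank_vectorSpan_range_add_one_le ℝ (fun x : P.extremePoints ℝ => (x : X))
  rw [Subtype.range_coe, ← Nat.card_eq_fintype_card, Nat.card_coe_set_eq] at h2
  omega

/-- A vertex has at least two neighbours outside a set of at most `dim P - 2` points. -/
theorem IsPolytope.exists_two_adj [FiniteDimensional ℝ X] {P : Set X} (hP : IsPolytope P)
    {S : Finset X} (hS : S.card + 2 ≤ dim P) {w : X} (hw : w ∈ P.extremePoints ℝ) (hwS : w ∉ S) :
    ∃ u₁ u₂, (skeleton P).Adj w u₁ ∧ (skeleton P).Adj w u₂ ∧ u₁ ≠ u₂ ∧ u₁ ∉ S ∧ u₂ ∉ S := by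
  classical
  have main : ∀ T : Finset X, T.card < dim P → w ∉ T → ∃ u, (skeleton P).Adj w u ∧ u ∉ T := by
    intro T hT hwT
    by_contra! hcon
    obtain ⟨y, hy, hyT⟩ : ∃ y ∈ P.extremePoints ℝ, y ∉ (insert w T : Finset X) := by
      by_contra! hsub
      have h1 : (P.extremePoints ℝ).ncard ≤ (insert w T).card := by
        rw [← Set.ncard_coe_finset]
        exact Set.ncard_le_ncard hsub (Finset.finite_toSet _)
      have h2 := Finset.card_insert_le w T
      have h3 := hP.dim_lt_ncard ⟨w, hw.1⟩
      omega
    rw [Finset.mem_insert, not_or] at hyT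
    -- Were all neighbours of `w` in `T`, colouring `w` alone would be constant along edges outside
    -- `T`.
    refine hyT.1 ((hP.iff_of_card_lt_dim hT (φ := fun x => x = w) ?_ hw hwT hy hyT.2).1 rfl)
    intro a b hab ha hb
    constructor
    · rintro rfl
      exact absurd (hcon b hab) hb
    · rintro rfl
      exact absurd (hcon a hab.symm) ha
  obtain ⟨u₁, h1, h1S⟩ := main S (by omega) hwS
  obtain ⟨u₂, h2, h2S⟩ := main (insert u₁ S) (by
    have := Finset.card_insert_le u₁ S
    omega) (by
      rw [Finset.mem_insert, not_or]
      exact ⟨h1.ne, hwS⟩)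
  rw [Finset.mem_insert, not_or] at h2S
  exact ⟨u₁, u₂, h1, h2, Ne.symm h2S.1, h1S, h2S.2⟩

/-! ### Decomposing functions of the skeleton -/

/-- A decomposing function of the skeleton which is affine with scalar linear part on all but at
most `dim P - 2` vertices is so on all vertices. -/
theorem IsPolytope.eq_smul_add_of_isDecomposing [FiniteDimensional ℝ X] {P : Set X}
    (hP : IsPolytope P) {f : X → X} (hf : (skeleton P).IsDecomposing f) {V : Set X} {a : ℝ} {x : X}
    (hfV : ∀ v ∈ V, f v = a • v + x) (hcard : (P.extremePoints ℝ \ V).ncard + 2 ≤ dim P) :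
    ∀ v ∈ P.extremePoints ℝ, f v = a • v + x := by
  classical
  intro w hw
  by_cases hwV : w ∈ V
  · exact hfV w hwV
  have hWfin : (P.extremePoints ℝ \ V).Finite := hP.finite_extremePoints.subset Set.sdiff_subset
  obtain ⟨u₁, u₂, h1, h2, hne, h1S, h2S⟩ := hP.exists_two_adj (S := hWfin.toFinset.erase w) (by
    have h1 := Finset.card_erase_le (s := hWfin.toFinset) (a := w)
    rw [← Set.ncard_eq_toFinset_card _ hWfin] at h1
    omega) hw (Finset.notMem_erase _ _)
  have hV : ∀ u, (skeleton P).Adj w u → u ∉ hWfin.toFinset.erase w → u ∈ V := by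
    intro u hwu hu
    by_contra huV
    exact hu (Finset.mem_erase.2 ⟨hwu.ne.symm, hWfin.mem_toFinset.2 ⟨hwu.2.1, huV⟩⟩)
  obtain ⟨c₁, hc₁⟩ := hf w u₁ h1
  obtain ⟨c₂, hc₂⟩ := hf w u₂ h2
  rw [hfV u₁ (hV u₁ h1 h1S)] at hc₁
  rw [hfV u₂ (hV u₂ h2 h2S)] at hc₂
  -- Both edges express `f w - (a • w + x)`, as multiples of the non-parallel vectors `w - u₁` and
  -- `w - u₂`; hence it is zero.
  have h0 := (smul_sub_eq_smul_sub_of_extremePoints hw h1.2.1 h2.2.1 h1.ne h2.ne hne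
    (α := c₁ - a) (β := c₂ - a) (by linear_combination (norm := module) hc₁ - hc₂)).1
  rw [sub_eq_zero.1 h0] at hc₁
  linear_combination (norm := module) hc₁

/-- A decomposing function of the skeleton restricts to an affine function with scalar linear part
on the union of two indecomposable subgraphs that share a vertex and miss few vertices. -/
theorem IsPolytope.exists_smul_add_of_two_subgraphs [FiniteDimensional ℝ X] {P : Set X}
    (hP : IsPolytope P) {G₁ G₂ : GeometricGraph X} (h₁ : G₁ ≤ skeleton P) (h₂ : G₂ ≤ skeleton P)
    (hG₁ : G₁.IsIndecomposable) (hG₂ : G₂.IsIndecomposable)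
    (hne : (G₁.verts ∩ G₂.verts).Nonempty)
    (hcard : (P.extremePoints ℝ \ (G₁.verts ∪ G₂.verts)).ncard + 2 ≤ dim P)
    {f : X → X} (hf : (skeleton P).IsDecomposing f) :
    ∃ (a : ℝ) (x : X), ∀ v ∈ G₁.verts ∪ G₂.verts, f v = a • v + x := by
  classical
  obtain ⟨a₁, x₁, hf₁⟩ := hG₁.exists_smul_add (hf.mono h₁)
  obtain ⟨a₂, x₂, hf₂⟩ := hG₂.exists_smul_add (hf.mono h₂)
  obtain ⟨v₀, hv₁, hv₂⟩ := hne
  have e₀ : a₁ • v₀ + x₁ = a₂ • v₀ + x₂ := (hf₁ v₀ hv₁).symm.trans (hf₂ v₀ hv₂)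
  have hdone : a₁ = a₂ → ∃ (a : ℝ) (x : X), ∀ v ∈ G₁.verts ∪ G₂.verts, f v = a • v + x := by
    rintro rfl
    refine ⟨a₁, x₁, fun v hv => hv.elim (hf₁ v) fun hv => ?_⟩
    rw [hf₂ v hv, add_left_cancel e₀]
  -- Under inclusion `a₁ = a₂` can fail, since a single vertex admits every ratio, but the pair of
  -- the larger graph serves.
  by_cases hs₁ : G₁.verts ⊆ G₂.verts
  · exact ⟨a₂, x₂, fun v hv => hf₂ v (hv.elim (@hs₁ v) id)⟩
  by_cases hs₂ : G₂.verts ⊆ G₁.verts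
  · exact ⟨a₁, x₁, fun v hv => hf₁ v (hv.elim id (@hs₂ v))⟩
  obtain ⟨u₁, hu₁, hu₁'⟩ := Set.not_subset.1 hs₁
  obtain ⟨u₂, hu₂, hu₂'⟩ := Set.not_subset.1 hs₂
  apply hdone
  have hWfin : (P.extremePoints ℝ \ (G₁.verts ∪ G₂.verts)).Finite :=
    hP.finite_extremePoints.subset Set.sdiff_subset
  set S := insert v₀ hWfin.toFinset with hSdef
  have hS : S.card < dim P := by
    have h1 := Finset.card_insert_le v₀ hWfin.toFinset
    rw [← Set.ncard_eq_toFinset_card _ hWfin, ← hSdef] at h1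
    omega
  have hmemS : ∀ u, u ∉ S → u ∈ P.extremePoints ℝ → u ≠ v₀ ∧ (u ∈ G₁.verts ∨ u ∈ G₂.verts) := by
    intro u hu hup
    rw [hSdef, Finset.mem_insert, not_or, Set.Finite.mem_toFinset] at hu
    refine ⟨hu.1, ?_⟩
    by_contra h
    exact hu.2 ⟨hup, h⟩
  have hnotS : ∀ u, u ≠ v₀ → (u ∈ G₁.verts ∨ u ∈ G₂.verts) → u ∉ S := by
    intro u hu huG
    rw [hSdef, Finset.mem_insert, not_or, Set.Finite.mem_toFinset]
    exact ⟨hu, fun h => h.2 huG⟩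
  have hadj : ∀ p q, (skeleton P).Adj p q → p ∉ S → q ∉ S → p ∈ G₁.verts → q ∉ G₁.verts →
      a₁ = a₂ := by
    intro p q hpq hpS hqS hp hq
    have hq₂ := (hmemS q hqS hpq.2.1).2.resolve_left hq
    obtain ⟨c, hc⟩ := hf p q hpq
    rw [hf₁ p hp, hf₂ q hq₂] at hc
    have h := smul_sub_eq_smul_sub_of_extremePoints (h₁.1 hv₁) hpq.1 hpq.2.1
      (hmemS p hpS hpq.1).1.symm (hmemS q hqS hpq.2.1).1.symm hpq.ne
      (α := a₁ - c) (β := a₂ - c) (by linear_combination (norm := module) hc - e₀)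
    linarith [h.1, h.2]
  by_contra hcon
  refine hu₂' ((hP.iff_of_card_lt_dim hS (φ := fun u => u ∈ G₁.verts) ?_ (h₁.1 hu₁)
    (hnotS u₁ (fun h => hu₁' (h ▸ hv₂)) (Or.inl hu₁)) (h₂.1 hu₂)
    (hnotS u₂ (fun h => hu₂' (h ▸ hv₁)) (Or.inr hu₂))).1 hu₁)
  intro p q hpq hp hq
  constructor
  · intro h
    by_contra h'
    exact hcon (hadj p q hpq hp hq h h')
  · intro h
    by_contra h'
    exact hcon (hadj q p hpq.symm hq hp h h')

/-! ### Minkowski summands -/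

/-- If `v = q + r` maximises a functional over `Q + R`, then `q` maximises it over `Q`. -/
theorem le_of_forall_mem_add_le {Q R : Set X} {q r : X} (hr : r ∈ R) {l : StrongDual ℝ X}
    (hmax : ∀ y ∈ Q + R, l y ≤ l (q + r)) : ∀ y ∈ Q, l y ≤ l q := by
  intro y hy
  have := hmax (y + r) (Set.add_mem_add hy hr)
  simpa using this

/-- The `Q`-components of the vertices of `Q + R` form a decomposing function of the skeleton. -/
theorem isDecomposing_of_add {Q R : Set X} {f g : X → X}
    (hf : ∀ v ∈ (Q + R).extremePoints ℝ, f v ∈ Q) (hg : ∀ v ∈ (Q + R).extremePoints ℝ, g v ∈ R)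
    (hfg : ∀ v ∈ (Q + R).extremePoints ℝ, f v + g v = v) :
    (skeleton (Q + R)).IsDecomposing f := by
  rintro v w ⟨hv, hw, -, hexp⟩
  obtain ⟨l, hl⟩ := hexp ⟨v, left_mem_segment ℝ v w⟩
  have hvmax : ∀ y ∈ Q + R, l y ≤ l v := (hl ▸ left_mem_segment ℝ v w :
    v ∈ {x ∈ Q + R | ∀ y ∈ Q + R, l y ≤ l x}).2
  have hwmax : ∀ y ∈ Q + R, l y ≤ l w := (hl ▸ right_mem_segment ℝ v w :
    w ∈ {x ∈ Q + R | ∀ y ∈ Q + R, l y ≤ l x}).2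
  have hq := le_of_forall_mem_add_le (hg v hv) (by rwa [hfg v hv]) (f w) (hf w hw)
  -- Exchanging summands stays in the exposed face, because `f v` maximises `l` on `Q` and `g w` is
  -- the `R`-part of a maximiser.
  have hmem : f v + g w ∈ segment ℝ v w := by
    rw [hl]
    refine ⟨Set.add_mem_add (hf v hv) (hg w hw), fun y hy => (hwmax y hy).trans ?_⟩
    rw [← hfg w hw, map_add, map_add, hfg w hw]
    linarith
  obtain ⟨a, b, -, -, hab, h⟩ := hmem
  refine ⟨a, ?_⟩
  have hw' := hfg w hw
  obtain rfl : b = 1 - a := by linarith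
  linear_combination (norm := module) -hw' - h

/-- If the `Q`-components of the vertices of a polytope `Q + R` are given by `v ↦ a • v + x`, then
`Q` is the image of `Q + R` under that map. -/
theorem eq_image_of_forall_extremePoints {Q R : Set X} (hP : IsPolytope (Q + R))
    (hQc : Convex ℝ Q) {f g : X → X}
    (hf : ∀ v ∈ (Q + R).extremePoints ℝ, f v ∈ Q) (hg : ∀ v ∈ (Q + R).extremePoints ℝ, g v ∈ R)
    (hfg : ∀ v ∈ (Q + R).extremePoints ℝ, f v + g v = v) {a : ℝ} {x : X}
    (hax : ∀ v ∈ (Q + R).extremePoints ℝ, f v = a • v + x) (hRne : R.Nonempty) :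
    Q = (fun y => a • y + x) '' (Q + R) := by
  have himage : (fun y => a • y + x) '' (Q + R) =
      convexHull ℝ ((fun y => a • y + x) '' (Q + R).extremePoints ℝ) := by
    have h := (AffineMap.homothety (k := ℝ) (0 : X) a + AffineMap.const ℝ X x).image_convexHull
      ((Q + R).extremePoints ℝ)
    rw [convexHull_extremePoints_eq hP.isCompact hP.convex hP.finite_extremePoints] at h
    have hfun : ⇑(AffineMap.homothety (k := ℝ) (0 : X) a + AffineMap.const ℝ X x) =
        fun y => a • y + x := by
      ext y
      simp [AffineMap.homothety_apply]
    rwa [hfun] at h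
  apply Set.Subset.antisymm
  · intro y hy
    by_contra hnot
    have hclosed : IsClosed ((fun y => a • y + x) '' (Q + R)) :=
      (hP.isCompact.image (by fun_prop)).isClosed
    -- A functional separating `y` from the image is maximised over `Q` at some `f v`, which lies in
    -- the image.
    obtain ⟨l, c, h1, h2⟩ := geometric_hahn_banach_closed_point
      (himage ▸ convex_convexHull ℝ _) hclosed hnot
    obtain ⟨r, hr⟩ := hRne
    obtain ⟨v, hv, hvmax⟩ := hP.exists_extremePoint_forall_le ⟨y + r, Set.add_mem_add hy hr⟩ l
    have h3 := le_of_forall_mem_add_le (hg v hv) (by rwa [hfg v hv]) y hy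
    have h4 := h1 _ ⟨v, hv.1, rfl⟩
    simp only [← hax v hv] at h4
    linarith
  · rw [himage]
    refine convexHull_min ?_ hQc
    rintro _ ⟨v, hv, rfl⟩
    simp only [← hax v hv]
    exact hf v hv

/-- In the situation of `eq_image_of_forall_extremePoints`, a nontrivial summand comes with a
positive ratio. -/
theorem pos_of_eq_image {Q R : Set X} (hP : IsPolytope (Q + R)) (hQ : Q.Nontrivial) {f g : X → X}
    (hg : ∀ v ∈ (Q + R).extremePoints ℝ, g v ∈ R)
    (hfg : ∀ v ∈ (Q + R).extremePoints ℝ, f v + g v = v) {a : ℝ} {x : X}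
    (hax : ∀ v ∈ (Q + R).extremePoints ℝ, f v = a • v + x)
    (himage : Q = (fun y => a • y + x) '' (Q + R)) : 0 < a := by
  obtain ⟨p, hp, q, hq, hpq⟩ := hQ
  by_contra! ha
  obtain ⟨l, hl⟩ := geometric_hahn_banach_point_point hpq
  obtain ⟨p', hp', rfl⟩ := himage.subset hp
  obtain ⟨v, hv, hvmax⟩ := hP.exists_extremePoint_forall_le ⟨p', hp'⟩ l
  have h1 := le_of_forall_mem_add_le (hg v hv) (by rwa [hfg v hv]) q hq
  -- With `a ≤ 0`, the maximality of `v` gives `l (f v) ≤ l p < l q`, whereas `f v` maximises `l` on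
  -- `Q`.
  have h2 := mul_le_mul_of_nonpos_left (hvmax p' hp') ha
  rw [hax v hv] at h1
  simp only [map_add, map_smul, smul_eq_mul] at hl h1
  linarith

/-- A polytope whose skeleton has only decomposing functions of the form `v ↦ a • v + x` is
indecomposable. -/
theorem IsPolytope.isIndecomposable_of_skeleton {P : Set X} (hP : IsPolytope P)
    (h : ∀ f, (skeleton P).IsDecomposing f →
      ∃ (a : ℝ) (x : X), ∀ v ∈ P.extremePoints ℝ, f v = a • v + x) :
    IsIndecomposable P := by
  rintro ⟨Q, R, hQ, hR, rfl, hsim⟩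
  have hdec : ∀ v : X, ∃ q r, v ∈ ((Q : Set X) + R).extremePoints ℝ →
      q ∈ (Q : Set X) ∧ r ∈ (R : Set X) ∧ q + r = v := by
    intro v
    by_cases hv : v ∈ ((Q : Set X) + R).extremePoints ℝ
    · obtain ⟨q, hq, r, hr, hqr⟩ := hv.1
      exact ⟨q, r, fun _ => ⟨hq, hr, hqr⟩⟩
    · exact ⟨0, 0, fun h => absurd h hv⟩
  choose f g hfg using hdec
  obtain ⟨a, x, hax⟩ := h f (isDecomposing_of_add (fun v hv => (hfg v hv).1)
    (fun v hv => (hfg v hv).2.1) fun v hv => (hfg v hv).2.2)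
  have hQeq := eq_image_of_forall_extremePoints hP Q.convex (fun v hv => (hfg v hv).1)
    (fun v hv => (hfg v hv).2.1) (fun v hv => (hfg v hv).2.2) hax hR.nonempty
  have ha := pos_of_eq_image hP hQ (fun v hv => (hfg v hv).2.1)
    (fun v hv => (hfg v hv).2.2) hax hQeq
  have hcomm : (Q : Set X) + R = R + Q := add_comm _ _
  have hbx : ∀ v ∈ ((Q : Set X) + R).extremePoints ℝ, g v = (1 - a) • v + -x := by
    intro v hv
    have h1 := (hfg v hv).2.2
    rw [hax v hv] at h1
    linear_combination (norm := module) h1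
  have hgf : ∀ v ∈ ((Q : Set X) + R).extremePoints ℝ, g v + f v = v := fun v hv => by
    rw [add_comm, (hfg v hv).2.2]
  have hf := fun v hv => (hfg v hv).1
  have hg := fun v hv => (hfg v hv).2.1
  rw [hcomm] at hP hf hg hbx hgf
  have hReq := eq_image_of_forall_extremePoints hP R.convex hg hf hgf hbx hQ.nonempty
  have hb := pos_of_eq_image hP hR hf hgf hbx hReq
  -- With `P = Q + R`, eliminate `P` from `Q = a • P + x` and `R = (1 - a) • P - x`.
  refine hsim ⟨a / (1 - a), div_pos ha hb, x + (a / (1 - a)) • x, ?_⟩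
  conv_lhs => rw [hQeq, hcomm]
  conv_rhs => rw [hReq]
  rw [Set.image_image]
  refine Set.image_congr fun y _ => ?_
  match_scalars <;> field_simp <;> ring

/-- A polytope is indecomposable if two indecomposable subgraphs of its skeleton share a vertex and
together miss at most `dim P - 2` vertices. -/
theorem IsPolytope.isIndecomposable_of_two_subgraphs [FiniteDimensional ℝ X] {P : Set X}
    (hP : IsPolytope P) {G₁ G₂ : GeometricGraph X} (h₁ : G₁ ≤ skeleton P) (h₂ : G₂ ≤ skeleton P)
    (hG₁ : G₁.IsIndecomposable) (hG₂ : G₂.IsIndecomposable)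
    (hne : (G₁.verts ∩ G₂.verts).Nonempty)
    (hcard : (P.extremePoints ℝ \ (G₁.verts ∪ G₂.verts)).ncard + 2 ≤ dim P) :
    IsIndecomposable P := by
  refine hP.isIndecomposable_of_skeleton fun f hf => ?_
  obtain ⟨a, x, hax⟩ := hP.exists_smul_add_of_two_subgraphs h₁ h₂ hG₁ hG₂ hne hcard hf
  exact ⟨a, x, hP.eq_smul_add_of_isDecomposing hf hax hcard⟩

end Polytope

theorem theorem4 {X : Type*} [NormedAddCommGroup X] [NormedSpace ℝ X] [FiniteDimensional ℝ X] :
    -- (i)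
    (∀ (H : GeometricGraph X) (G : H.edgeSet → GeometricGraph X),
      H.IsIndecomposable →
      (∀ e : H.edgeSet, (G e).IsIndecomposable) →
      (∀ e : H.edgeSet, ∀ u ∈ (e : Sym2 X), u ∈ (G e).verts) →
      GeometricGraph.IsIndecomposable (⨆ e : H.edgeSet, G e)) ∧
    -- (ii)
    (∀ (n : ℕ) [NeZero n] (G : Fin n → GeometricGraph X) (v : Fin n → X),
      (∀ i : Fin n, (G i).IsIndecomposable) →
      AffineIndependent ℝ v →
      -- `i - 1` is the cyclic predecessor of `i`
      (∀ i : Fin n, v i ∈ (G i).verts ∩ (G (i - 1)).verts) →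
      GeometricGraph.IsIndecomposable (⨆ i : Fin n, G i)) ∧
    -- (iii)
    (∀ (P : Set X) (d : ℕ) (G₁ G₂ : GeometricGraph X),
      Polytope.IsPolytope P →
      Polytope.dim P = d →
      G₁ ≤ Polytope.skeleton P →
      G₂ ≤ Polytope.skeleton P →
      G₁.IsIndecomposable →
      G₂.IsIndecomposable →
      (G₁.verts ∩ G₂.verts).Nonempty →
      (((Polytope.skeleton P).verts \ (G₁.verts ∪ G₂.verts)).ncard : ℤ) ≤ (d : ℤ) - 2 →
      Polytope.IsIndecomposable P) := by
  refine ⟨GeometricGraph.isIndecomposable_iSup_edgeSet,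
    fun n _ => GeometricGraph.isIndecomposable_iSup_cycle n, ?_⟩
  rintro P d G₁ G₂ hP rfl h₁ h₂ hG₁ hG₂ hne hcard
  refine hP.isIndecomposable_of_two_subgraphs h₁ h₂ hG₁ hG₂ hne ?_
  -- The integer inequality forces `dim P ≥ 2`, so it passes to `ℕ` without truncation.
  change ((P.extremePoints ℝ \ (G₁.verts ∪ G₂.verts)).ncard : ℤ) ≤ (Polytope.dim P : ℤ) - 2 at hcard
  omega
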